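/- Let $p>5$ be a prime and put $H(1)=\sum_{k=1}^{p-1}\frac1k\in\mathbb{Q}$. For rational numbers $x,y$ and $n\ge 0$ write $x\equiv y \pmod{p^n}$ if $x-y=p^n\,\frac{a}{b}$ for some integers $a,b$ with $p\nmid b$. Then $$\sum_{k=1}^{p-1}\frac{1}{k^2}\binom{2k}{k}^{-1}\equiv \frac13\cdot\frac{H(1)}{p}\pmod{p^3}$$ and $$\sum_{k=1}^{p-1}\frac{(-1)^k}{k^3}\binom{2k}{k}^{-1}\equiv -\frac25\cdot\frac{H(1)}{p^2}\pmod{p^3}.$$ -/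

import Mathlib

/-- Congruence of rational numbers modulo the prime power `p ^ n`: the difference `x - y` is
`p ^ n` times a fraction of integers whose denominator is prime to `p`, that is, an element of
`p ^ n ℤ_(p)`. (Neither `x` nor `y` has to be `p`-integral.) -/
def RatModEq (p n : ℕ) (x y : ℚ) : Prop :=
  ∃ a b : ℤ, ¬ (p : ℤ) ∣ b ∧ x - y = (p : ℚ) ^ n * ((a : ℚ) / (b : ℚ))

/-- The harmonic sum `H(1) = ∑_{k=1}^{p-1} 1/k`. -/
def harmonicSum (p : ℕ) : ℚ :=
  ∑ k ∈ Finset.Icc 1 (p - 1), 1 / (k : ℚ)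

/-!
Both congruences come from finite versions of Apéry's series, whose remainder term can be expanded
`p`-adically when the length of the sum is `p - 1`. Write `H(r) = ∑_{k<p} 1 / k ^ r` (`powSum`).

The identities `three_mul_sum_inv_centralBinom` and `five_mul_sum_inv_centralBinom` express
`3 ∑ 1 / (k ^ 2 C(2k,k))` and `5 ∑ (-1)^k / (k ^ 3 C(2k,k))`, `k ≤ n`, through `H(2)`, `H(3)` and the
sums `∑ 1 / (k ^ 2 C(n+k,k))` and `∑ (-1)^k / (k ^ 3 C(n,k) C(n+k,k))`. For `n = p - 1` one has
`(p + k) C(p-1+k,k) = p C(p+k,k)` with `C(p+k,k) = ∏_{j ≤ k} (1 + p / j)` and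
`(-1)^k C(p-1,k) = ∏_{j ≤ k} (1 - p / j)`, so these sums become combinations of `H(r)` and of double
harmonic sums, up to the required power of `p`. The factor `p` in `C(p-1+k,k)` costs up to two powers
of `p`, which is why the expansions are carried that far.

What remains are congruences among harmonic sums. The substitution `k ↦ p - k` gives
`2 H(1) ≡ -p H(2) - p² H(3) - p³ H(4)` modulo `p ^ 5` and `2 H(3) ≡ -3 p H(4)` modulo `p ^ 3`, while
`H(2), H(4), H(5) ≡ 0` modulo `p` by Fermat (here `p > 5` is used). The double sums are handled
without Bernoulli numbers. The alternating sum `∑ (-1)^(k-1) C(p-1,k) / k ^ r` is on the one hand a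
complete homogeneous symmetric polynomial in the `1 / k`, hence a polynomial in the `H(i)`
(`altChooseSum_two`, `altChooseSum_four`), and on the other hand a combination of double sums by the
expansion of `C(p-1,k)`. For `r = 2` this settles the first congruence
(`sum_inv_sq_mul_inv_choose_mem`); for `r = 4` it evaluates `∑ 1 / (j k ^ 4)`, `j ≤ k`, modulo `p`
(`sum_powSum_one_mul_mem`). The sum `∑ 1 / (j ^ 2 k ^ 3)`, which the second congruence needs, is `-2`
times that one modulo `p`, by a shuffle relation (`dblSum_two_three_add_mem`).
-/

/-! ### Rational numbers divisible by a power of `p` -/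

/-- The subring `ℤ_(p)` of `ℚ`: fractions of integers whose denominator is prime to `p`. -/
def pIntegral (p : ℕ) [hp : Fact p.Prime] : Subring ℚ where
  carrier := {x | ∃ a b : ℤ, ¬ (p : ℤ) ∣ b ∧ x = a / b}
  mul_mem' := by
    rintro _ _ ⟨a, b, hb, rfl⟩ ⟨c, d, hd, rfl⟩
    refine ⟨a * c, b * d, fun h => ?_, by push_cast; rw [div_mul_div_comm]⟩
    exact ((Nat.prime_iff_prime_int.1 hp.out).dvd_or_dvd h).elim hb hd
  one_mem' := ⟨1, 1, fun h => hp.out.one_lt.ne' (by simpa [Int.natCast_dvd] using h), by simp⟩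
  add_mem' := by
    rintro _ _ ⟨a, b, hb, rfl⟩ ⟨c, d, hd, rfl⟩
    have hb0 : (b : ℚ) ≠ 0 := by rintro h; simp at h; simp [h] at hb
    have hd0 : (d : ℚ) ≠ 0 := by rintro h; simp at h; simp [h] at hd
    refine ⟨a * d + b * c, b * d, fun h => ?_, by push_cast; rw [div_add_div _ _ hb0 hd0]⟩
    exact ((Nat.prime_iff_prime_int.1 hp.out).dvd_or_dvd h).elim hb hd
  zero_mem' := ⟨0, 1, fun h => hp.out.one_lt.ne' (by simpa [Int.natCast_dvd] using h), by simp⟩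
  neg_mem' := by
    rintro _ ⟨a, b, hb, rfl⟩
    exact ⟨-a, b, hb, by push_cast; rw [neg_div]⟩

/-- The additive subgroup `p ^ n ℤ_(p)` of `ℚ`. -/
def pMul (p : ℕ) [Fact p.Prime] (n : ℕ) : AddSubgroup ℚ where
  carrier := {x | ∃ y ∈ pIntegral p, x = (p : ℚ) ^ n * y}
  add_mem' := by
    rintro _ _ ⟨y, hy, rfl⟩ ⟨z, hz, rfl⟩
    exact ⟨y + z, add_mem hy hz, by ring⟩
  zero_mem' := ⟨0, zero_mem _, by simp⟩
  neg_mem' := by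
    rintro _ ⟨y, hy, rfl⟩
    exact ⟨-y, neg_mem hy, by ring⟩

theorem not_dvd_of_mem_Icc {p k : ℕ} (hk : k ∈ Finset.Icc 1 (p - 1)) : ¬ p ∣ k := by
  rw [Finset.mem_Icc] at hk
  exact Nat.not_dvd_of_pos_of_lt (by lia) (by lia)

theorem sum_Icc_reflect (f : ℕ → ℚ) (n : ℕ) :
    ∑ k ∈ Finset.Icc 1 n, f (n + 1 - k) = ∑ k ∈ Finset.Icc 1 n, f k := by
  refine Finset.sum_bij' (fun k _ => n + 1 - k) (fun k _ => n + 1 - k) ?_ ?_ ?_ ?_ ?_ <;>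
    simp only [Finset.mem_Icc] <;> intros <;> first | rfl | lia

/-- The substitution `k ↦ p - k`, for a summand that is a function of the rational number `k`. -/
theorem sum_Icc_sub_reflect {p : ℕ} (hp' : 1 ≤ p) (f : ℚ → ℚ) :
    ∑ k ∈ Finset.Icc 1 (p - 1), f ((p : ℚ) - k) = ∑ k ∈ Finset.Icc 1 (p - 1), f k := by
  rw [← sum_Icc_reflect (fun k => f k)]
  refine Finset.sum_congr rfl fun k hk => ?_
  rw [Finset.mem_Icc] at hk
  rw [Nat.sub_add_cancel hp', Nat.cast_sub (by lia)]

section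

variable {p : ℕ} [hp : Fact p.Prime] {m n : ℕ} {x y : ℚ}

theorem ratModEq_of_sub_mem (h : x - y ∈ pMul p n) : RatModEq p n x y := by
  obtain ⟨_, ⟨a, b, hb, rfl⟩, h⟩ := h
  exact ⟨a, b, hb, h⟩

theorem pMul_pow_mul (n : ℕ) (hx : x ∈ pIntegral p) : (p : ℚ) ^ n * x ∈ pMul p n :=
  ⟨x, hx, rfl⟩

theorem pMul_mul (hx : x ∈ pMul p m) (hy : y ∈ pMul p n) : x * y ∈ pMul p (m + n) := by
  obtain ⟨a, ha, rfl⟩ := hx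
  obtain ⟨b, hb, rfl⟩ := hy
  exact ⟨a * b, mul_mem ha hb, by ring⟩

theorem pIntegral_mul_pMul (hx : x ∈ pIntegral p) (hy : y ∈ pMul p n) : x * y ∈ pMul p n := by
  obtain ⟨b, hb, rfl⟩ := hy
  exact ⟨x * b, mul_mem hx hb, by ring⟩

theorem pow_mul_pMul (m : ℕ) (hy : y ∈ pMul p n) : (p : ℚ) ^ m * y ∈ pMul p (m + n) := by
  obtain ⟨b, hb, rfl⟩ := hy
  exact ⟨b, hb, by ring⟩

theorem pMul_anti (hmn : m ≤ n) (hx : x ∈ pMul p n) : x ∈ pMul p m := by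
  obtain ⟨b, hb, rfl⟩ := hx
  refine ⟨(p : ℚ) ^ (n - m) * b, mul_mem (pow_mem (natCast_mem _ _) _) hb, ?_⟩
  rw [← mul_assoc, ← pow_add, Nat.add_sub_cancel' hmn]

theorem pMul_of_pow_mul (m : ℕ) (hx : (p : ℚ) ^ m * x ∈ pMul p (m + n)) : x ∈ pMul p n := by
  obtain ⟨b, hb, h⟩ := hx
  have h0 : (p : ℚ) ^ m ≠ 0 := pow_ne_zero _ (Nat.cast_ne_zero.2 hp.out.ne_zero)
  exact ⟨b, hb, mul_left_cancel₀ h0 (by rw [h]; ring)⟩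

theorem inv_natCast_mem_pIntegral {k : ℕ} (hk : ¬ p ∣ k) : (k : ℚ)⁻¹ ∈ pIntegral p :=
  ⟨1, k, by rwa [Int.natCast_dvd_natCast], by simp⟩

theorem pMul_of_natCast_mul {k : ℕ} (hk : ¬ p ∣ k) (hx : (k : ℚ) * x ∈ pMul p n) :
    x ∈ pMul p n := by
  have h0 : (k : ℚ) ≠ 0 := by rintro h; simp at h; simp [h] at hk
  have := pIntegral_mul_pMul (inv_natCast_mem_pIntegral hk) hx
  rwa [inv_mul_cancel_left₀ h0] at this

theorem not_dvd_two_mul {k : ℕ} (hp2 : 2 < p) (hk : 0 < k) (hkp : k < p) : ¬ p ∣ 2 * k := fun h =>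
  ((Nat.Prime.dvd_mul hp.out).1 h).elim (Nat.not_dvd_of_pos_of_lt (by lia) hp2)
    (Nat.not_dvd_of_pos_of_lt hk hkp)

theorem one_div_pow_mem_pIntegral {k : ℕ} (hk : k ∈ Finset.Icc 1 (p - 1)) (r : ℕ) :
    1 / (k : ℚ) ^ r ∈ pIntegral p := by
  rw [one_div, ← inv_pow]
  exact pow_mem (inv_natCast_mem_pIntegral (not_dvd_of_mem_Icc hk)) r

/-! ### Expansion of products -/

/-- The quadratic coefficient is the second elementary symmetric polynomial of the `u j`, written in
power sums; halving it is harmless because `p` is odd. -/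
theorem prod_one_add_expansion (h2 : ¬ p ∣ 2) {ι : Type*} (s : Finset ι) (u : ι → ℚ)
    (hu : ∀ j ∈ s, u j ∈ pIntegral p) {x : ℚ} (hx : x ∈ pIntegral p) :
    ∃ z ∈ pIntegral p, ∏ j ∈ s, (1 + x * u j) =
      1 + x * ∑ j ∈ s, u j + x ^ 2 * (((∑ j ∈ s, u j) ^ 2 - ∑ j ∈ s, u j ^ 2) / 2) + x ^ 3 * z := by
  classical
  have hh : (2 : ℚ)⁻¹ ∈ pIntegral p := by exact_mod_cast inv_natCast_mem_pIntegral h2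
  induction s using Finset.induction_on with
  | empty => exact ⟨0, zero_mem _, by simp⟩
  | insert a s ha ih =>
    obtain ⟨z, hz, h⟩ := ih fun j hj => hu j (Finset.mem_insert_of_mem hj)
    have hua := hu a (Finset.mem_insert_self _ _)
    have h1 := sum_mem fun j hj => hu j (Finset.mem_insert_of_mem hj)
    have h2 := sum_mem fun j hj => pow_mem (hu j (Finset.mem_insert_of_mem hj)) 2
    simp only [Finset.prod_insert ha, Finset.sum_insert ha, h]
    set A := ∑ j ∈ s, u j
    set B := ∑ j ∈ s, u j ^ 2
    -- The new remainder collects the terms of degree three and more in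
    -- `(1 + x A + x² (A² - B) / 2 + x³ z) (1 + x u)`.
    refine ⟨z + u a * ((A ^ 2 - B) * 2⁻¹) + x * u a * z, ?_, by ring⟩
    exact add_mem (add_mem hz (mul_mem hua (mul_mem (sub_mem (pow_mem h1 2) h2) hh)))
      (mul_mem (mul_mem hx hua) hz)

/-- Like `prod_one_add_expansion` for the reciprocal: the quadratic coefficient is now the second
complete homogeneous symmetric polynomial of the `u j`. -/
theorem inv_prod_one_add_expansion (h2 : ¬ p ∣ 2) {ι : Type*} (s : Finset ι) (u : ι → ℚ)
    (hu : ∀ j ∈ s, u j ∈ pIntegral p) {x : ℚ} (h0 : ∀ j ∈ s, 1 + x * u j ≠ 0)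
    (hi : ∀ j ∈ s, (1 + x * u j)⁻¹ ∈ pIntegral p) :
    ∃ z ∈ pIntegral p, (∏ j ∈ s, (1 + x * u j))⁻¹ =
      1 - x * ∑ j ∈ s, u j + x ^ 2 * (((∑ j ∈ s, u j) ^ 2 + ∑ j ∈ s, u j ^ 2) / 2) + x ^ 3 * z := by
  classical
  have hh : (2 : ℚ)⁻¹ ∈ pIntegral p := by exact_mod_cast inv_natCast_mem_pIntegral h2
  induction s using Finset.induction_on with
  | empty => exact ⟨0, zero_mem _, by simp⟩
  | insert a s ha ih =>
    obtain ⟨z, hz, h⟩ := ih (fun j hj => hu j (Finset.mem_insert_of_mem hj))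
      (fun j hj => h0 j (Finset.mem_insert_of_mem hj))
      (fun j hj => hi j (Finset.mem_insert_of_mem hj))
    have hua := hu a (Finset.mem_insert_self _ _)
    have h0a := h0 a (Finset.mem_insert_self _ _)
    have hia := hi a (Finset.mem_insert_self _ _)
    have h1 := sum_mem fun j hj => hu j (Finset.mem_insert_of_mem hj)
    have h2 := sum_mem fun j hj => pow_mem (hu j (Finset.mem_insert_of_mem hj)) 2
    simp only [Finset.prod_insert ha, Finset.sum_insert ha, mul_inv, h]
    set A := ∑ j ∈ s, u j
    set B := ∑ j ∈ s, u j ^ 2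
    -- This remainder solves `(1 + x u) * (new expansion) = old expansion`.
    refine ⟨(1 + x * u a)⁻¹ * (z - (A ^ 2 + B) * 2⁻¹ * u a - A * u a ^ 2 - u a ^ 3), ?_, ?_⟩
    · exact mul_mem hia (sub_mem (sub_mem (sub_mem hz (mul_mem (mul_mem
        (add_mem (pow_mem h1 2) h2) hh) hua)) (mul_mem h1 (pow_mem hua 2))) (pow_mem hua 3))
    · field_simp
      ring

/-! ### Power sums of reciprocals -/

/-- The generalized harmonic number `∑_{k=1}^n 1 / k ^ r`. -/
def powSum (r n : ℕ) : ℚ := ∑ k ∈ Finset.Icc 1 n, 1 / (k : ℚ) ^ r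

theorem powSum_zero_right (r : ℕ) : powSum r 0 = 0 := by simp [powSum]

theorem powSum_succ (r n : ℕ) : powSum r (n + 1) = powSum r n + 1 / ((n : ℚ) + 1) ^ r := by
  rw [powSum, Finset.sum_Icc_succ_top (by lia), powSum]
  push_cast
  rfl

theorem powSum_mem_pIntegral (r : ℕ) (hn : n ≤ p - 1) : powSum r n ∈ pIntegral p :=
  sum_mem fun _ hk => one_div_pow_mem_pIntegral
    (Finset.Icc_subset_Icc_right hn hk) r

/-- By Fermat's little theorem `1 / k ^ r ≡ k ^ (p - 1 - r)` modulo `p`, and power sums over the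
field `ZMod p` with such an exponent vanish. -/
theorem powSum_mem_pMul_one {r : ℕ} (hr : 0 < r) (hr' : r < p - 1) :
    powSum r (p - 1) ∈ pMul p 1 := by
  have key : ((∑ k ∈ Finset.Icc 1 (p - 1), k ^ (p - 1 - r) : ℕ) : ZMod p) = 0 := by
    have h := FiniteField.sum_pow_lt_card_sub_one (K := ZMod p) (p - 1 - r)
      (by rw [ZMod.card]; lia)
    rw [← h]
    have hins : Finset.range p = insert 0 (Finset.Icc 1 (p - 1)) := by
      ext k; have := hp.out.pos; simp; lia
    have h3 : ∑ k ∈ Finset.range p, ((k : ZMod p)) ^ (p - 1 - r) =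
        ∑ x : ZMod p, x ^ (p - 1 - r) := by
      refine Finset.sum_bij' (fun k _ => (k : ZMod p)) (fun x _ => x.val) ?_ ?_ ?_ ?_ ?_
      · simp
      · intro x _; simpa using ZMod.val_lt x
      · intro k hk; exact ZMod.val_cast_of_lt (by simpa using hk)
      · intro x _; simp
      · simp
    rw [← h3, hins, Finset.sum_insert (by simp)]
    have : p - 1 - r ≠ 0 := by lia
    simp [this]
  rw [ZMod.natCast_eq_zero_iff] at key
  obtain ⟨c, hc⟩ := key
  have h1 : powSum r (p - 1) - ((∑ k ∈ Finset.Icc 1 (p - 1), k ^ (p - 1 - r) : ℕ) : ℚ)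
      ∈ pMul p 1 := by
    rw [powSum, Nat.cast_sum, ← Finset.sum_sub_distrib]
    refine sum_mem fun k hk => ?_
    have hnd := not_dvd_of_mem_Icc hk
    have hk0 : (k : ℚ) ≠ 0 := by rintro h; simp at h; simp [h] at hnd
    have hf : (p : ℤ) ∣ 1 - (k : ℤ) ^ (p - 1) := by
      rw [← ZMod.intCast_zmod_eq_zero_iff_dvd]
      push_cast
      rw [ZMod.pow_card_sub_one_eq_one, sub_self]
      rwa [Ne, ZMod.natCast_eq_zero_iff]
    obtain ⟨d, hd⟩ := hf
    refine ⟨d * (1 / (k : ℚ) ^ r), mul_mem (intCast_mem _ _) (one_div_pow_mem_pIntegral hk r), ?_⟩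
    have hd' : (1 : ℚ) - (k : ℚ) ^ (p - 1) = p * d := by exact_mod_cast hd
    have hs : (k : ℚ) ^ (p - 1) = (k : ℚ) ^ (p - 1 - r) * (k : ℚ) ^ r := by
      rw [← pow_add]; congr 1; lia
    push_cast
    rw [pow_one, ← mul_assoc, ← hd', hs]
    field_simp
  have h2 : ((∑ k ∈ Finset.Icc 1 (p - 1), k ^ (p - 1 - r) : ℕ) : ℚ) ∈ pMul p 1 :=
    ⟨c, natCast_mem _ _, by rw [hc]; push_cast; ring⟩
  simpa using add_mem h1 h2

theorem one_div_sub_pow_mem_pIntegral {k : ℕ} (hk : k ∈ Finset.Icc 1 (p - 1)) (r : ℕ) :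
    1 / ((p : ℚ) - k) ^ r ∈ pIntegral p := by
  have h := Finset.mem_Icc.1 hk
  rw [← Nat.cast_sub (by lia)]
  exact one_div_pow_mem_pIntegral (Finset.mem_Icc.2 ⟨by lia, by lia⟩) r

/-- Obtained by adding the geometric expansion of `1 / (p - k)` in powers of `p / k` to `1 / k` and
summing over `k`. -/
theorem two_mul_powSum_one_expansion :
    2 * powSum 1 (p - 1) + p * powSum 2 (p - 1) + p ^ 2 * powSum 3 (p - 1)
      + p ^ 3 * powSum 4 (p - 1) + p ^ 4 * powSum 5 (p - 1) ∈ pMul p 5 := by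
  have hr := sum_Icc_sub_reflect hp.out.one_le fun x => 1 / x ^ 1
  rw [two_mul]
  nth_rewrite 1 [powSum]
  rw [← hr]
  simp only [powSum, Finset.mul_sum, ← Finset.sum_add_distrib]
  refine sum_mem fun k hk => ⟨1 / (k : ℚ) ^ 5 * (1 / ((p : ℚ) - k) ^ 1),
    mul_mem (one_div_pow_mem_pIntegral hk 5) (one_div_sub_pow_mem_pIntegral hk 1), ?_⟩
  have h := Finset.mem_Icc.1 hk
  have hk0 : (k : ℚ) ≠ 0 := Nat.cast_ne_zero.2 (by lia)
  have hk1 : (p : ℚ) - k ≠ 0 := by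
    rw [← Nat.cast_sub (by lia)]; exact Nat.cast_ne_zero.2 (by lia)
  field_simp
  ring

/-- Obtained by adding the expansion of `1 / (p - k) ^ 3` in powers of `p / k` to `1 / k ^ 3` and
summing over `k`. -/
theorem two_mul_powSum_three_expansion :
    2 * powSum 3 (p - 1) + 3 * p * powSum 4 (p - 1) + 6 * p ^ 2 * powSum 5 (p - 1)
      ∈ pMul p 3 := by
  have hr := sum_Icc_sub_reflect hp.out.one_le fun x => 1 / x ^ 3
  rw [two_mul]
  nth_rewrite 1 [powSum]
  rw [← hr]
  simp only [powSum, Finset.mul_sum, ← Finset.sum_add_distrib]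
  -- With `x = p / k`, the tail `1 / (1 - x) ^ 3 - 1 - 3 x - 6 x ^ 2` of the binomial series is
  -- `x ^ 3 (10 - 15 x + 6 x ^ 2) / (1 - x) ^ 3`.
  refine sum_mem fun k hk => ⟨(10 * k ^ 2 - 15 * p * k + 6 * p ^ 2 : ℤ)
    * (1 / (k : ℚ) ^ 5 * (1 / ((p : ℚ) - k) ^ 3)), mul_mem (intCast_mem _ _)
    (mul_mem (one_div_pow_mem_pIntegral hk 5) (one_div_sub_pow_mem_pIntegral hk 3)), ?_⟩
  have h := Finset.mem_Icc.1 hk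
  have hk0 : (k : ℚ) ≠ 0 := Nat.cast_ne_zero.2 (by lia)
  have hk1 : (p : ℚ) - k ≠ 0 := by
    rw [← Nat.cast_sub (by lia)]; exact Nat.cast_ne_zero.2 (by lia)
  push_cast
  field_simp
  ring

theorem powSum_three_mem_pMul_two (hp5 : 5 < p) : powSum 3 (p - 1) ∈ pMul p 2 := by
  have h4 := pow_mul_pMul 1 (powSum_mem_pMul_one (p := p) (r := 4) (by lia) (by lia))
  have h5 : (p : ℚ) ^ 2 * powSum 5 (p - 1) ∈ pMul p 2 :=
    pMul_pow_mul 2 (powSum_mem_pIntegral 5 le_rfl)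
  have h := pMul_anti (m := 2) (by lia) (two_mul_powSum_three_expansion (p := p))
  refine pMul_of_natCast_mul (k := 2) (Nat.not_dvd_of_pos_of_lt (by lia) (by lia)) ?_
  convert sub_mem h (add_mem (pIntegral_mul_pMul (natCast_mem _ 3) h4)
    (pIntegral_mul_pMul (natCast_mem _ 6) h5)) using 1
  push_cast
  ring

theorem powSum_one_mem_pMul_two (hp5 : 5 < p) : powSum 1 (p - 1) ∈ pMul p 2 := by
  have h2 := pow_mul_pMul 1 (powSum_mem_pMul_one (p := p) (r := 2) (by lia) (by lia))
  have hI : ∀ r, powSum r (p - 1) ∈ pIntegral p := fun r => powSum_mem_pIntegral r le_rfl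
  have h := pMul_anti (m := 2) (by lia) (two_mul_powSum_one_expansion (p := p))
  refine pMul_of_natCast_mul (k := 2) (Nat.not_dvd_of_pos_of_lt (by lia) (by lia)) ?_
  convert sub_mem h (add_mem h2 (add_mem (pMul_pow_mul 2 (hI 3)) (add_mem
    (pMul_anti (by lia) (pMul_pow_mul 3 (hI 4)))
    (pMul_anti (by lia) (pMul_pow_mul 4 (hI 5)))))) using 1
  push_cast
  ring

end

/-! ### Finite Apéry-type identities -/

theorem cast_choose_succ_mul (n k : ℕ) :
    ((n + 1).choose (k + 1) : ℚ) * (k + 1) = (n + 1) * n.choose k := by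
  exact_mod_cast (Nat.add_one_mul_choose_eq n k).symm

theorem cast_choose_mul_sub {n k : ℕ} (hk : k ≤ n) :
    ((n + 1).choose k : ℚ) * (n + 1 - k) = (n + 1) * n.choose k := by
  have h := Nat.choose_mul_succ_eq n k
  have h' : (n.choose k : ℚ) * (n + 1) = (n + 1).choose k * ((n + 1 - k : ℕ) : ℚ) := by
    exact_mod_cast h
  rw [Nat.cast_sub (by lia)] at h'
  push_cast at h'
  linarith

theorem cast_centralBinom_succ (n : ℕ) :
    ((2 * (n + 1)).choose (n + 1) : ℚ) = 2 * ((n + 1 + n).choose n : ℚ) := by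
  have h := Nat.centralBinom_eq_two_mul_choose (n + 1)
  rw [Nat.centralBinom_eq_two_mul_choose] at h
  have h1 : (2 * (n + 1)).choose (n + 1) = (n + 1 + n).choose n + (n + 1 + n).choose (n + 1) := by
    rw [show 2 * (n + 1) = (n + 1 + n) + 1 by ring, Nat.choose_succ_succ]
  have h2 : (n + 1 + n).choose (n + 1) = (n + 1 + n).choose n :=
    Nat.choose_symm_of_eq_add rfl
  rw [h1, h2]
  push_cast
  ring

/-- The change of `∑ 1 / (k ^ 2 C(n+k,k))` under `n ↦ n + 1` telescopes in `k`. -/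
theorem sum_inv_choose_add_sub (n m : ℕ) :
    ∑ k ∈ Finset.Icc 1 m, (1 / ((k : ℚ) ^ 2 * (n + 1 + k).choose k)
      - 1 / ((k : ℚ) ^ 2 * (n + k).choose k)) =
      -(1 / ((n : ℚ) + 1) ^ 2) * (1 - 1 / (n + 1 + m).choose m) := by
  induction m with
  | zero => simp
  | succ m ih =>
    rw [Finset.sum_Icc_succ_top (by lia), ih]
    have h1 := cast_choose_succ_mul (n + 1 + m) m
    have h2 := cast_choose_mul_sub (n := n + 1 + m) (k := m + 1) (by lia)
    have hc : ((n + 1 + m).choose m : ℚ) ≠ 0 :=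
      Nat.cast_ne_zero.2 (Nat.choose_pos (by lia)).ne'
    rw [show n + (m + 1) = n + 1 + m by ring, show n + 1 + (m + 1) = n + 1 + m + 1 by ring]
    push_cast at h1 h2 ⊢
    set c := ((n + 1 + m).choose m : ℚ)
    have hm : (m : ℚ) + 1 ≠ 0 := by positivity
    have hn : (n : ℚ) + 1 ≠ 0 := by positivity
    have hnm : (n : ℚ) + 1 + m + 1 ≠ 0 := by positivity
    have e1 : ((n + 1 + m + 1).choose (m + 1) : ℚ) = (n + 1 + m + 1) * c / (m + 1) := by
      field_simp; linarith
    have e2 : ((n + 1 + m).choose (m + 1) : ℚ) = (n + 1) * c / (m + 1) := by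
      rw [e1] at h2
      apply mul_left_cancel₀ hnm
      rw [← h2]; field_simp; ring
    rw [e1, e2]
    field_simp
    ring

theorem three_mul_sum_inv_centralBinom (n : ℕ) :
    3 * ∑ k ∈ Finset.Icc 1 n, 1 / ((k : ℚ) ^ 2 * (2 * k).choose k) =
      powSum 2 n + ∑ k ∈ Finset.Icc 1 n, 1 / ((k : ℚ) ^ 2 * (n + k).choose k) := by
  induction n with
  | zero => simp [powSum]
  | succ n ih =>
    have h := sum_inv_choose_add_sub n n
    rw [Finset.sum_sub_distrib] at h
    rw [Finset.sum_Icc_succ_top (by lia), mul_add, ih, powSum_succ,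
      Finset.sum_Icc_succ_top (by lia), sub_eq_iff_eq_add.1 h,
      show n + 1 + (n + 1) = 2 * (n + 1) by ring, cast_centralBinom_succ]
    have hc : ((n + 1 + n).choose n : ℚ) ≠ 0 :=
      Nat.cast_ne_zero.2 (Nat.choose_pos (by lia)).ne'
    have hn : (n : ℚ) + 1 ≠ 0 := by positivity
    push_cast
    field_simp
    ring

/-- The change of `∑ (-1)^k / (k ^ 3 C(n,k) C(n+k,k))` under `n ↦ n + 1` telescopes in `k`. This is
Apéry's computation for `ζ(3)`. -/
theorem sum_inv_choose_mul_choose_sub (n m : ℕ) (hm : m ≤ n) :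
    ∑ k ∈ Finset.Icc 1 m,
      ((-1 : ℚ) ^ k / ((k : ℚ) ^ 3 * ((n + 1).choose k * (n + 1 + k).choose k))
        - (-1 : ℚ) ^ k / ((k : ℚ) ^ 3 * (n.choose k * (n + k).choose k))) =
      2 / ((n : ℚ) + 1) ^ 3 - 2 / ((n : ℚ) + 1) ^ 2 * ((-1) ^ m /
        ((n + 1 - m) * ((n + 1).choose m * (n + 1 + m).choose m))) := by
  induction m with
  | zero => simp; field_simp; ring
  | succ m ih =>
    rw [Finset.sum_Icc_succ_top (by lia), ih (by lia)]
    obtain ⟨d, rfl⟩ := Nat.exists_eq_add_of_le hm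
    set n := m + 1 + d with hn_def
    have h1 := cast_choose_succ_mul (n + 1 + m) m
    have h2 := cast_choose_mul_sub (n := n + 1 + m) (k := m + 1) (by lia)
    have h3 := cast_choose_succ_mul n m
    have h4 := cast_choose_mul_sub (n := n) (k := m) (by lia)
    have h5 := cast_choose_mul_sub (n := n) (k := m + 1) (by lia)
    have hc : ((n + 1 + m).choose m : ℚ) ≠ 0 :=
      Nat.cast_ne_zero.2 (Nat.choose_pos (by lia)).ne'
    have hb : ((n + 1).choose m : ℚ) ≠ 0 :=
      Nat.cast_ne_zero.2 (Nat.choose_pos (by lia)).ne'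
    rw [show n + (m + 1) = n + 1 + m by ring, show n + 1 + (m + 1) = n + 1 + m + 1 by ring]
    have hnm : (n : ℚ) = m + 1 + d := by rw [hn_def]; push_cast; ring
    clear_value n
    push_cast at h1 h2 h3 h4 h5 ⊢
    set c := ((n + 1 + m).choose m : ℚ)
    set b := ((n + 1).choose m : ℚ)
    have hm : (m : ℚ) + 1 ≠ 0 := by positivity
    have hn : (n : ℚ) + 1 ≠ 0 := by positivity
    have hnm' : (n : ℚ) + 1 + m + 1 ≠ 0 := by positivity
    have hd1 : (n : ℚ) + 1 - (m + 1) ≠ 0 := by rw [hnm]; ring_nf; positivity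
    have hd2 : (n : ℚ) + 1 - m ≠ 0 := by rw [hnm]; ring_nf; positivity
    have e1 : ((n + 1 + m + 1).choose (m + 1) : ℚ) = (n + 1 + m + 1) * c / (m + 1) := by
      field_simp; linarith
    have e2 : ((n + 1 + m).choose (m + 1) : ℚ) = (n + 1) * c / (m + 1) := by
      rw [e1] at h2
      apply mul_left_cancel₀ hnm'
      rw [← h2]; field_simp; ring
    have e3 : ((n + 1).choose (m + 1) : ℚ) = b * (n + 1 - m) / (m + 1) := by
      field_simp; linarith
    have e4 : (n.choose (m + 1) : ℚ) = b * (n + 1 - m) * (n + 1 - (m + 1)) / ((m + 1) * (n + 1)) := by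
      rw [e3] at h5
      apply mul_left_cancel₀ hn
      rw [← h5]; field_simp
    rw [e1, e2, e3, e4, pow_succ]
    field_simp
    ring

theorem five_mul_sum_inv_centralBinom (n : ℕ) :
    5 * ∑ k ∈ Finset.Icc 1 n, (-1 : ℚ) ^ k / ((k : ℚ) ^ 3 * (2 * k).choose k) =
      -2 * powSum 3 n + ∑ k ∈ Finset.Icc 1 n,
        (-1 : ℚ) ^ k / ((k : ℚ) ^ 3 * (n.choose k * (n + k).choose k)) := by
  induction n with
  | zero => simp [powSum]
  | succ n ih =>
    have h := sum_inv_choose_mul_choose_sub n n le_rfl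
    rw [Finset.sum_sub_distrib] at h
    rw [Finset.sum_Icc_succ_top (by lia), mul_add, ih, powSum_succ,
      Finset.sum_Icc_succ_top (by lia), sub_eq_iff_eq_add.1 h,
      show n + 1 + (n + 1) = 2 * (n + 1) by ring, cast_centralBinom_succ,
      Nat.choose_succ_self_right, Nat.choose_self]
    have hc : ((n + 1 + n).choose n : ℚ) ≠ 0 :=
      Nat.cast_ne_zero.2 (Nat.choose_pos (by lia)).ne'
    have hn : (n : ℚ) + 1 ≠ 0 := by positivity
    push_cast
    field_simp
    ring

/-! ### Alternating binomial sums -/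

/-- The alternating sum `∑_{k=1}^n (-1)^(k-1) C(n,k) / k ^ r`. For `r ≥ 1` it is the complete
homogeneous symmetric polynomial of degree `r` in `1, 1/2, …, 1/n`. -/
def altChooseSum (r n : ℕ) : ℚ :=
  -∑ k ∈ Finset.Icc 1 n, (-1 : ℚ) ^ k * n.choose k * (1 / (k : ℚ) ^ r)

theorem altChooseSum_zero_right (r : ℕ) : altChooseSum r 0 = 0 := by simp [altChooseSum]

theorem altChooseSum_zero_left (n : ℕ) : altChooseSum 0 (n + 1) = 1 := by
  have h := Int.alternating_sum_range_choose (n := n + 1)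
  rw [if_neg (by lia), Finset.sum_range_succ'] at h
  have h' : ∑ k ∈ Finset.range (n + 1), (-1 : ℚ) ^ (k + 1) * (n + 1).choose (k + 1) = -1 := by
    have : (∑ k ∈ Finset.range (n + 1), (-1 : ℤ) ^ (k + 1) * (n + 1).choose (k + 1)) = -1 := by
      simp at h; linarith
    exact_mod_cast this
  rw [altChooseSum, Finset.range_eq_Ico, Finset.sum_Ico_add'
    (fun k => (-1 : ℚ) ^ k * (n + 1).choose k)] at *
  simp only [pow_zero, div_one, mul_one]
  rw [show Finset.Icc 1 (n + 1) = Finset.Ico (0 + 1) (n + 1 + 1) from rfl, h', neg_neg]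

/-- The recursion of the complete homogeneous symmetric polynomials in `1, 1/2, …, 1/n`. It comes from
`C(n+1,k) - C(n,k) = k / (n + 1) * C(n+1,k)`. -/
theorem altChooseSum_succ (r n : ℕ) :
    altChooseSum (r + 1) (n + 1) =
      altChooseSum (r + 1) n + altChooseSum r (n + 1) / ((n : ℚ) + 1) := by
  have hn : altChooseSum (r + 1) n =
      -∑ k ∈ Finset.Icc 1 (n + 1), (-1 : ℚ) ^ k * n.choose k * (1 / (k : ℚ) ^ (r + 1)) := by
    rw [Finset.sum_Icc_succ_top (by lia), Nat.choose_eq_zero_of_lt n.lt_succ_self]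
    simp [altChooseSum]
  rw [hn, altChooseSum, altChooseSum, neg_div, ← neg_add, neg_inj, Finset.sum_div,
    ← Finset.sum_add_distrib]
  refine Finset.sum_congr rfl fun k hk => ?_
  rw [Finset.mem_Icc] at hk
  obtain ⟨k, rfl⟩ := Nat.exists_eq_add_of_le' hk.1
  have h1 := cast_choose_succ_mul n k
  have h2 : ((n + 1).choose (k + 1) : ℚ) = n.choose k + n.choose (k + 1) := by
    exact_mod_cast Nat.choose_succ_succ n k
  have hk0 : (k : ℚ) + 1 ≠ 0 := by positivity
  have hn0 : (n : ℚ) + 1 ≠ 0 := by positivity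
  have h3 : (n.choose k : ℚ) = (n + 1).choose (k + 1) * (k + 1) / (n + 1) := by
    field_simp; linarith
  have h4 : (n.choose (k + 1) : ℚ) =
      (n + 1).choose (k + 1) - (n + 1).choose (k + 1) * (k + 1) / (n + 1) := by linarith
  rw [h4]
  push_cast
  field_simp
  ring

theorem altChooseSum_one (n : ℕ) : altChooseSum 1 n = powSum 1 n := by
  induction n with
  | zero => rw [altChooseSum_zero_right, powSum_zero_right]
  | succ n ih => rw [altChooseSum_succ, ih, powSum_succ, altChooseSum_zero_left, pow_one]

theorem altChooseSum_two (n : ℕ) :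
    2 * altChooseSum 2 n = powSum 1 n ^ 2 + powSum 2 n := by
  induction n with
  | zero => simp [altChooseSum_zero_right, powSum_zero_right]
  | succ n ih =>
    rw [altChooseSum_succ, mul_add, ih, altChooseSum_one]
    simp only [powSum_succ, ← one_div_pow]
    ring

theorem altChooseSum_three (n : ℕ) :
    6 * altChooseSum 3 n = powSum 1 n ^ 3 + 3 * powSum 1 n * powSum 2 n + 2 * powSum 3 n := by
  induction n with
  | zero => simp [altChooseSum_zero_right, powSum_zero_right]
  | succ n ih =>
    rw [altChooseSum_succ, mul_add, ih]
    have h := altChooseSum_two (n + 1)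
    simp only [powSum_succ, ← one_div_pow] at h ⊢
    linear_combination 3 * (1 / ((n : ℚ) + 1)) * h

/-- Newton's expression of a complete homogeneous symmetric polynomial in power sums; so are
`altChooseSum_two` and `altChooseSum_three`. -/
theorem altChooseSum_four (n : ℕ) :
    24 * altChooseSum 4 n = powSum 1 n ^ 4 + 6 * powSum 1 n ^ 2 * powSum 2 n
      + 3 * powSum 2 n ^ 2 + 8 * powSum 1 n * powSum 3 n + 6 * powSum 4 n := by
  induction n with
  | zero => simp [altChooseSum_zero_right, powSum_zero_right]
  | succ n ih =>
    rw [altChooseSum_succ, mul_add, ih]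
    have h := altChooseSum_three (n + 1)
    simp only [powSum_succ, ← one_div_pow] at h ⊢
    linear_combination 4 * (1 / ((n : ℚ) + 1)) * h

/-! ### Binomial coefficients near a prime -/

theorem cast_choose_add_eq_prod (n k : ℕ) :
    ((n + k).choose k : ℚ) = ∏ j ∈ Finset.Icc 1 k, (1 + (n : ℚ) * (1 / (j : ℚ) ^ 1)) := by
  induction k with
  | zero => simp
  | succ k ih =>
    rw [Finset.prod_Icc_succ_top (by lia), ← ih]
    have h := cast_choose_succ_mul (n + k) k
    rw [← add_assoc]
    have hk : (k : ℚ) + 1 ≠ 0 := by positivity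
    push_cast at h ⊢
    apply mul_right_cancel₀ hk
    rw [h]
    field_simp
    ring

theorem neg_one_pow_mul_choose_eq_prod {n k : ℕ} (hk : k ≤ n) :
    (-1 : ℚ) ^ k * n.choose k =
      ∏ j ∈ Finset.Icc 1 k, (1 + -((n : ℚ) + 1) * (1 / (j : ℚ) ^ 1)) := by
  induction k with
  | zero => simp
  | succ k ih =>
    rw [Finset.prod_Icc_succ_top (by lia), ← ih (by lia)]
    have h : (n.choose (k + 1) : ℚ) * (k + 1) = n.choose k * (n - k) := by
      have := Nat.choose_succ_right_eq n k
      rw [← Nat.cast_sub (by lia)]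
      exact_mod_cast this
    have hk : (k : ℚ) + 1 ≠ 0 := by positivity
    push_cast at h ⊢
    apply mul_right_cancel₀ hk
    rw [mul_assoc, h, pow_succ]
    field_simp
    ring

theorem cast_choose_add_mul (n k : ℕ) :
    ((n + k).choose k : ℚ) * (n + 1 + k) = (n + 1) * (n + 1 + k).choose k := by
  have h := cast_choose_mul_sub (n := n + k) (k := k) (by lia)
  rw [show n + 1 + k = n + k + 1 by ring]
  push_cast at h
  linarith

/-- Telescoping, since the differences of `1 / C(n+k,k)` are `-n / (k C(n+k,k))`. -/
theorem mul_sum_inv_choose_add (n m : ℕ) :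
    (n : ℚ) * ∑ k ∈ Finset.Icc 1 m, 1 / (k : ℚ) * ((n + k).choose k : ℚ)⁻¹ =
      1 - ((n + m).choose m : ℚ)⁻¹ := by
  induction m with
  | zero => simp
  | succ m ih =>
    rw [Finset.sum_Icc_succ_top (by lia), mul_add, ih]
    have h := cast_choose_succ_mul (n + m) m
    have hc : ((n + m).choose m : ℚ) ≠ 0 := Nat.cast_ne_zero.2 (Nat.choose_pos (by lia)).ne'
    have hm : (m : ℚ) + 1 ≠ 0 := by positivity
    have hn : (n : ℚ) + m + 1 ≠ 0 := by positivity
    have e : ((n + (m + 1)).choose (m + 1) : ℚ) = (n + m + 1) * (n + m).choose m / (m + 1) := by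
      rw [← add_assoc]; push_cast at h; field_simp; linarith
    rw [e]
    push_cast
    field_simp
    ring

section

variable {p : ℕ} [hp : Fact p.Prime]

theorem inv_choose_add_expansion (hp2 : 2 < p) {k : ℕ} (hk : k ≤ p - 1) :
    ∃ z ∈ pIntegral p, ((p + k).choose k : ℚ)⁻¹ =
      1 - p * powSum 1 k + p ^ 2 * ((powSum 1 k ^ 2 + powSum 2 k) / 2) + p ^ 3 * z := by
  have hne : ∀ j ∈ Finset.Icc 1 k, (1 : ℚ) + p * (1 / (j : ℚ) ^ 1) ≠ 0 :=
    fun j _ => by positivity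
  obtain ⟨z, hz, h⟩ := inv_prod_one_add_expansion (p := p)
    (Nat.not_dvd_of_pos_of_lt (by lia) hp2) (Finset.Icc 1 k)
    (fun j => 1 / (j : ℚ) ^ 1)
    (fun j hj => one_div_pow_mem_pIntegral (Finset.Icc_subset_Icc_right hk hj) 1) hne
    (fun j hj => by
      rw [Finset.mem_Icc] at hj
      have hnd : ¬ p ∣ j + p := by
        rw [Nat.dvd_add_self_right]; exact Nat.not_dvd_of_pos_of_lt (by lia) (by lia)
      have := mul_mem (natCast_mem (pIntegral p) j) (inv_natCast_mem_pIntegral hnd)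
      convert this using 1
      have hj0 : (j : ℚ) ≠ 0 := Nat.cast_ne_zero.2 (by lia)
      push_cast
      field_simp)
  refine ⟨z, hz, ?_⟩
  rw [cast_choose_add_eq_prod, h]
  simp only [powSum, ← one_div_pow, pow_one]

theorem neg_one_pow_mul_choose_expansion (hp2 : 2 < p) {k : ℕ} (hk : k ≤ p - 1) :
    ∃ z ∈ pIntegral p, (-1 : ℚ) ^ k * (p - 1).choose k =
      1 - p * powSum 1 k + p ^ 2 * ((powSum 1 k ^ 2 - powSum 2 k) / 2) + p ^ 3 * z := by
  obtain ⟨z, hz, h⟩ := prod_one_add_expansion (p := p)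
    (Nat.not_dvd_of_pos_of_lt (by lia) hp2) (Finset.Icc 1 k)
    (fun j => 1 / (j : ℚ) ^ 1)
    (fun j hj => one_div_pow_mem_pIntegral (Finset.Icc_subset_Icc_right hk hj) 1)
    (neg_mem (natCast_mem _ p))
  refine ⟨-z, neg_mem hz, ?_⟩
  have hp1 : ((p - 1 : ℕ) : ℚ) + 1 = p := by exact_mod_cast Nat.sub_add_cancel hp.out.one_le
  rw [neg_one_pow_mul_choose_eq_prod hk, hp1, h]
  simp only [powSum, ← one_div_pow, pow_one]
  ring

/-- Here `C(p+k,k) * (-1)^k C(p-1,k) = ∏_{j ≤ k} (1 - p ^ 2 / j ^ 2)` has only even powers of `p`. -/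
theorem inv_choose_mul_choose_expansion (hp2 : 2 < p) {k : ℕ} (hk : k ≤ p - 1) :
    ∃ z ∈ pIntegral p,
      (((p + k).choose k : ℚ) * ((-1 : ℚ) ^ k * (p - 1).choose k))⁻¹ =
      1 + p ^ 2 * powSum 2 k + p ^ 4 * ((powSum 2 k ^ 2 + powSum 4 k) / 2) + p ^ 6 * z := by
  have hfac : ∀ j ∈ Finset.Icc 1 k, (1 : ℚ) + -(p : ℚ) ^ 2 * (1 / (j : ℚ) ^ 2) ≠ 0 ∧
      ((1 : ℚ) + -(p : ℚ) ^ 2 * (1 / (j : ℚ) ^ 2))⁻¹ =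
        (j : ℚ) ^ 2 * -((((j + p : ℕ) : ℚ))⁻¹ * (1 / ((p : ℚ) - j) ^ 1)) := by
    intro j hj
    rw [Finset.mem_Icc] at hj
    have hj0 : (j : ℚ) ≠ 0 := Nat.cast_ne_zero.2 (by lia)
    have hj1 : (p : ℚ) - j ≠ 0 := by
      rw [← Nat.cast_sub (by lia)]; exact Nat.cast_ne_zero.2 (by lia)
    have hj2 : (j : ℚ) + p ≠ 0 := by positivity
    have e : (1 : ℚ) + -(p : ℚ) ^ 2 * (1 / (j : ℚ) ^ 2) =
        -(((p : ℚ) - j) * (j + p)) / (j : ℚ) ^ 2 := by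
      field_simp; ring
    rw [e]
    refine ⟨div_ne_zero (neg_ne_zero.2 (mul_ne_zero hj1 hj2)) (pow_ne_zero _ hj0), ?_⟩
    push_cast
    rw [inv_div, pow_one, div_neg, mul_neg, div_eq_mul_inv, mul_inv, one_div, mul_comm (_⁻¹) (_⁻¹)]
  obtain ⟨z, hz, h⟩ := inv_prod_one_add_expansion (p := p)
    (Nat.not_dvd_of_pos_of_lt (by lia) hp2) (Finset.Icc 1 k)
    (fun j => 1 / (j : ℚ) ^ 2)
    (fun j hj => one_div_pow_mem_pIntegral (Finset.Icc_subset_Icc_right hk hj) 2)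
    (x := -(p : ℚ) ^ 2) (fun j hj => (hfac j hj).1)
    (fun j hj => by
      rw [(hfac j hj).2]
      have hj' := Finset.mem_Icc.1 hj
      have hnd : ¬ p ∣ j + p := by
        rw [Nat.dvd_add_self_right]; exact Nat.not_dvd_of_pos_of_lt (by lia) (by lia)
      exact mul_mem (pow_mem (natCast_mem _ _) _) (neg_mem (mul_mem
        (inv_natCast_mem_pIntegral hnd)
        (one_div_sub_pow_mem_pIntegral (Finset.Icc_subset_Icc_right hk hj) 1))))
  refine ⟨-z, neg_mem hz, ?_⟩
  have hp1 : ((p - 1 : ℕ) : ℚ) + 1 = p := by exact_mod_cast Nat.sub_add_cancel hp.out.one_le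
  have hprod : ((p + k).choose k : ℚ) * ((-1 : ℚ) ^ k * (p - 1).choose k) =
      ∏ j ∈ Finset.Icc 1 k, (1 + -(p : ℚ) ^ 2 * (1 / (j : ℚ) ^ 2)) := by
    rw [neg_one_pow_mul_choose_eq_prod hk, hp1, cast_choose_add_eq_prod,
      ← Finset.prod_mul_distrib]
    refine Finset.prod_congr rfl fun j _ => ?_
    rw [← one_div_pow, ← one_div_pow]
    ring
  have hsq : ∀ j : ℕ, (1 / (j : ℚ) ^ 2) ^ 2 = 1 / (j : ℚ) ^ 4 := fun j => by
    rw [one_div_pow, ← pow_mul]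
  rw [hprod, h]
  simp only [powSum, hsq]
  ring

end

/-! ### Double harmonic sums -/

/-- The double harmonic sum `∑_{1 ≤ j < k ≤ n} 1 / (j ^ a k ^ b)`. -/
def dblSum (a b n : ℕ) : ℚ :=
  ∑ k ∈ Finset.Icc 1 n, ∑ j ∈ Finset.Icc 1 (k - 1), 1 / (j : ℚ) ^ a * (1 / (k : ℚ) ^ b)

theorem dblSum_succ (a b n : ℕ) :
    dblSum a b (n + 1) = dblSum a b n + powSum a n * (1 / ((n : ℚ) + 1) ^ b) := by
  rw [dblSum, Finset.sum_Icc_succ_top (by lia), ← dblSum, ← Finset.sum_mul, powSum]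
  push_cast
  rfl

theorem sum_powSum_mul (a b n : ℕ) :
    ∑ k ∈ Finset.Icc 1 n, powSum a k * (1 / (k : ℚ) ^ b) = dblSum a b n + powSum (a + b) n := by
  induction n with
  | zero => simp [dblSum, powSum]
  | succ n ih =>
    rw [Finset.sum_Icc_succ_top (by lia), ih, dblSum_succ, powSum_succ, powSum_succ, pow_add,
      ← one_div_mul_one_div]
    push_cast
    ring

/-- The quasi-shuffle (stuffle) product of two power sums. -/
theorem powSum_mul_powSum (a b n : ℕ) :
    powSum a n * powSum b n = dblSum a b n + dblSum b a n + powSum (a + b) n := by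
  induction n with
  | zero => simp [dblSum, powSum]
  | succ n ih =>
    rw [dblSum_succ, dblSum_succ, powSum_succ, powSum_succ, powSum_succ, pow_add,
      ← one_div_mul_one_div]
    linear_combination ih

/-- A shuffle relation: the partial fraction expansion of `1 / (i² j³)` with respect to
`k = i + j`, summed over `k ≤ n`. -/
theorem sum_inv_sub_sq_mul_cube (n : ℕ) :
    ∑ k ∈ Finset.Icc 1 n, ∑ j ∈ Finset.Icc 1 (k - 1),
      1 / ((k : ℚ) - j) ^ 2 * (1 / (j : ℚ) ^ 3) =
      dblSum 3 2 n + 3 * dblSum 2 3 n + 6 * dblSum 1 4 n := by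
  simp only [dblSum, Finset.mul_sum, ← Finset.sum_add_distrib]
  refine Finset.sum_congr rfl fun k hk => ?_
  rw [Finset.mem_Icc] at hk
  have hrefl : ∀ f : ℚ → ℚ, ∑ j ∈ Finset.Icc 1 (k - 1), f ((k : ℚ) - j) =
      ∑ j ∈ Finset.Icc 1 (k - 1), f j := fun f => sum_Icc_sub_reflect hk.1 f
  have h1 := hrefl fun x => 1 / (k : ℚ) ^ 3 * (1 / x ^ 2) + 3 * (1 / (k : ℚ) ^ 4 * (1 / x ^ 1))
  have h2 : ∀ j ∈ Finset.Icc 1 (k - 1), 1 / ((k : ℚ) - j) ^ 2 * (1 / (j : ℚ) ^ 3) =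
      (1 / (j : ℚ) ^ 3 * (1 / (k : ℚ) ^ 2) + 2 * (1 / (j : ℚ) ^ 2 * (1 / (k : ℚ) ^ 3))
        + 3 * (1 / (j : ℚ) ^ 1 * (1 / (k : ℚ) ^ 4))) +
      (1 / (k : ℚ) ^ 3 * (1 / ((k : ℚ) - j) ^ 2)
        + 3 * (1 / (k : ℚ) ^ 4 * (1 / ((k : ℚ) - j) ^ 1))) := by
    intro j hj
    rw [Finset.mem_Icc] at hj
    have hj0 : (j : ℚ) ≠ 0 := Nat.cast_ne_zero.2 (by lia)
    have hk0 : (k : ℚ) ≠ 0 := Nat.cast_ne_zero.2 (by lia)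
    have hkj : (k : ℚ) - j ≠ 0 := by
      rw [← Nat.cast_sub (by lia)]; exact Nat.cast_ne_zero.2 (by lia)
    field_simp
    ring
  rw [Finset.sum_congr rfl h2, Finset.sum_add_distrib, h1, ← Finset.sum_add_distrib]
  exact Finset.sum_congr rfl fun j _ => by ring

section

variable {p : ℕ} [hp : Fact p.Prime]

/-- The substitution `k ↦ p + j - k` turns `1 / (k - j) ^ 2` into `1 / (p - k) ^ 2 ≡ 1 / k ^ 2`
modulo `p`. -/
theorem sum_inv_sub_sq_mul_cube_sub_mem :
    ∑ k ∈ Finset.Icc 1 (p - 1), ∑ j ∈ Finset.Icc 1 (k - 1),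
      1 / ((k : ℚ) - j) ^ 2 * (1 / (j : ℚ) ^ 3) - dblSum 3 2 (p - 1) ∈ pMul p 1 := by
  have hswap : ∀ f : ℕ → ℕ → ℚ,
      ∑ k ∈ Finset.Icc 1 (p - 1), ∑ j ∈ Finset.Icc 1 (k - 1), f k j =
      ∑ j ∈ Finset.Icc 1 (p - 1), ∑ k ∈ Finset.Icc (j + 1) (p - 1), f k j := fun f =>
    Finset.sum_comm' fun k j => by simp only [Finset.mem_Icc]; lia
  have hrefl : ∀ (j : ℕ) (f : ℚ → ℚ), j ∈ Finset.Icc 1 (p - 1) →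
      ∑ k ∈ Finset.Icc (j + 1) (p - 1), f ((k : ℚ) - j) =
      ∑ k ∈ Finset.Icc (j + 1) (p - 1), f ((p : ℚ) - k) := by
    intro j f hj
    rw [Finset.mem_Icc] at hj
    refine Finset.sum_bij' (fun k _ => p + j - k) (fun k _ => p + j - k) ?_ ?_ ?_ ?_ ?_ <;>
      simp only [Finset.mem_Icc] <;> intro k hk
    · lia
    · lia
    · lia
    · lia
    · rw [Nat.cast_sub (by lia)]
      push_cast
      congr 1
      ring
  rw [dblSum, hswap, hswap, ← Finset.sum_sub_distrib]
  refine sum_mem fun j hj => ?_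
  rw [hrefl j (fun x => 1 / x ^ 2 * (1 / (j : ℚ) ^ 3)) hj, ← Finset.sum_sub_distrib]
  refine sum_mem fun k hk => ?_
  have hk' := Finset.mem_Icc.1 hk
  have hk1 : k ∈ Finset.Icc 1 (p - 1) := Finset.mem_Icc.2 ⟨by lia, hk'.2⟩
  have hk0 : (k : ℚ) ≠ 0 := Nat.cast_ne_zero.2 (by lia)
  have hj0 : (j : ℚ) ≠ 0 := Nat.cast_ne_zero.2 (by have := Finset.mem_Icc.1 hj; lia)
  have hpk : (p : ℚ) - k ≠ 0 := by
    rw [← Nat.cast_sub (by lia)]; exact Nat.cast_ne_zero.2 (by lia)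
  -- The numerator is that of `1 / (p - k) ^ 2 - 1 / k ^ 2`, divided by `p`.
  refine ⟨(2 * k - p : ℤ) * (1 / ((p : ℚ) - k) ^ 2 * (1 / (k : ℚ) ^ 2 * (1 / (j : ℚ) ^ 3))),
    mul_mem (intCast_mem _ _) (mul_mem (one_div_sub_pow_mem_pIntegral hk1 2) (mul_mem
      (one_div_pow_mem_pIntegral hk1 2) (one_div_pow_mem_pIntegral hj 3))), ?_⟩
  push_cast
  field_simp
  ring

/-- The two evaluations of the shuffle sum have `dblSum 3 2` in common, which leaves three times this
congruence. -/
theorem dblSum_two_three_add_mem (hp5 : 5 < p) :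
    dblSum 2 3 (p - 1) + 2 * dblSum 1 4 (p - 1) ∈ pMul p 1 := by
  have h := sum_inv_sub_sq_mul_cube_sub_mem (p := p)
  rw [sum_inv_sub_sq_mul_cube] at h
  refine pMul_of_natCast_mul (k := 3) (Nat.not_dvd_of_pos_of_lt (by lia) (by lia)) ?_
  convert h using 1
  push_cast
  ring

end

/-! ### Reciprocal sums of central binomial coefficients -/

section

variable {p : ℕ} [hp : Fact p.Prime]

theorem seven_le_of_prime (hp5 : 5 < p) : 7 ≤ p := by
  by_contra h
  exact absurd hp.out (by rw [show p = 6 by lia]; norm_num)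

theorem cast_pred_prime_add_one : ((p - 1 : ℕ) : ℚ) + 1 = p := by
  exact_mod_cast Nat.sub_add_cancel hp.out.one_le

theorem cast_choose_pred_add_mul (k : ℕ) :
    ((p - 1 + k).choose k : ℚ) * (p + k) = p * (p + k).choose k := by
  have h := cast_choose_add_mul (p - 1) k
  rwa [cast_pred_prime_add_one, Nat.sub_add_cancel hp.out.one_le] at h

theorem two_mul_sum_powSum_two_mul (n : ℕ) :
    2 * ∑ k ∈ Finset.Icc 1 n, powSum 2 k * (1 / (k : ℚ) ^ 2) = powSum 2 n ^ 2 + powSum 4 n := by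
  rw [sum_powSum_mul]
  linear_combination - powSum_mul_powSum 2 2 n

theorem two_mul_powSum_one_add_mem (hp5 : 5 < p) :
    2 * powSum 1 (p - 1) + p * powSum 2 (p - 1) ∈ pMul p 4 := by
  have h := pMul_anti (m := 4) (by lia) (two_mul_powSum_one_expansion (p := p))
  have h3 := pow_mul_pMul 2 (powSum_three_mem_pMul_two hp5)
  have h4 := pow_mul_pMul 3 (powSum_mem_pMul_one (p := p) (r := 4) (by lia) (by lia))
  have h5 := pMul_pow_mul 4 (powSum_mem_pIntegral (p := p) 5 le_rfl)
  convert sub_mem h (add_mem h3 (add_mem h4 h5)) using 1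
  ring

/-- Since `(-1)^(p-1) C(p-1,p-1) = 1`, the number `C(2p-1,p-1)` is the product of the
`1 - p ^ 2 / j ^ 2`, so the odd powers of `p` drop out. -/
theorem inv_choose_pred_expansion (hp5 : 5 < p) :
    1 - ((p + (p - 1)).choose (p - 1) : ℚ)⁻¹ + p ^ 2 * powSum 2 (p - 1) ∈ pMul p 5 := by
  obtain ⟨z, hz, h⟩ := inv_choose_mul_choose_expansion (p := p) (by lia) (le_refl (p - 1))
  have hev : Even (p - 1) := hp.out.even_sub_one (by lia)
  rw [hev.neg_one_pow, Nat.choose_self, Nat.cast_one, one_mul, mul_one] at h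
  have h2 := powSum_mem_pMul_one (p := p) (r := 2) (by lia) (by lia)
  have h4 := powSum_mem_pMul_one (p := p) (r := 4) (by lia) (by lia)
  have h24 : (powSum 2 (p - 1) ^ 2 + powSum 4 (p - 1)) / 2 ∈ pMul p 1 := by
    refine pMul_of_natCast_mul (k := 2) (Nat.not_dvd_of_pos_of_lt (by lia) (by lia)) ?_
    convert add_mem (pMul_anti (m := 1) (by lia) (pMul_mul h2 h2)) h4 using 1
    push_cast
    ring
  rw [h]
  convert neg_mem (add_mem (pow_mul_pMul 4 h24)
    (pMul_anti (m := 5) (by lia) (pMul_pow_mul 6 hz))) using 1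
  ring

/-- Modulo `p ^ 3` the numbers `1 / C(p+k,k)` and `(-1)^k C(p-1,k)` differ by
`p ^ 2 * powSum 2 k`, so the sum below reduces to an alternating binomial sum. -/
theorem sum_inv_sq_mul_inv_choose_mem (hp5 : 5 < p) :
    2 * ∑ k ∈ Finset.Icc 1 (p - 1), 1 / (k : ℚ) ^ 2 * ((p + k).choose k : ℚ)⁻¹
      + powSum 2 (p - 1) ∈ pMul p 3 := by
  have hterm : ∑ k ∈ Finset.Icc 1 (p - 1), 1 / (k : ℚ) ^ 2 * (((p + k).choose k : ℚ)⁻¹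
      - (-1 : ℚ) ^ k * (p - 1).choose k - p ^ 2 * powSum 2 k) ∈ pMul p 3 := by
    refine sum_mem fun k hk => pIntegral_mul_pMul (one_div_pow_mem_pIntegral hk 2) ?_
    have hk' := (Finset.mem_Icc.1 hk).2
    obtain ⟨z, hz, h⟩ := inv_choose_add_expansion (p := p) (by lia) hk'
    obtain ⟨w, hw, h'⟩ := neg_one_pow_mul_choose_expansion (p := p) (by lia) hk'
    refine ⟨z - w, sub_mem hz hw, ?_⟩
    rw [h, h']
    ring
  have hsplit : ∑ k ∈ Finset.Icc 1 (p - 1), 1 / (k : ℚ) ^ 2 * (((p + k).choose k : ℚ)⁻¹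
      - (-1 : ℚ) ^ k * (p - 1).choose k - p ^ 2 * powSum 2 k) =
      ∑ k ∈ Finset.Icc 1 (p - 1), 1 / (k : ℚ) ^ 2 * ((p + k).choose k : ℚ)⁻¹
        + altChooseSum 2 (p - 1)
        - p ^ 2 * ∑ k ∈ Finset.Icc 1 (p - 1), powSum 2 k * (1 / (k : ℚ) ^ 2) := by
    rw [altChooseSum, ← sub_eq_add_neg, Finset.mul_sum, ← Finset.sum_sub_distrib,
      ← Finset.sum_sub_distrib]
    exact Finset.sum_congr rfl fun k _ => by ring
  rw [hsplit] at hterm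
  have h1 := powSum_one_mem_pMul_two hp5
  have h2 := powSum_mem_pMul_one (p := p) (r := 2) (by lia) (by lia)
  have h4 := powSum_mem_pMul_one (p := p) (r := 4) (by lia) (by lia)
  have e1 := altChooseSum_two (p - 1)
  have e2 := two_mul_sum_powSum_two_mul (p - 1)
  convert sub_mem (add_mem (pIntegral_mul_pMul (natCast_mem _ 2) hterm)
    (pow_mul_pMul 2 (add_mem (pMul_anti (m := 1) (by lia) (pMul_mul h2 h2)) h4)))
    (pMul_anti (m := 3) (by lia) (pMul_mul h1 h1)) using 1
  push_cast
  linear_combination -e1 + (p : ℚ) ^ 2 * e2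

/-- Comes from `(-1)^k C(p-1,k) ≡ 1 - p * powSum 1 k` modulo `p ^ 2` and the evaluation of
`altChooseSum 4 (p - 1)`. -/
theorem sum_powSum_one_mul_mem (hp5 : 5 < p) :
    4 * p * ∑ k ∈ Finset.Icc 1 (p - 1), powSum 1 k * (1 / (k : ℚ) ^ 4) - 5 * powSum 4 (p - 1)
      ∈ pMul p 2 := by
  have hterm : ∑ k ∈ Finset.Icc 1 (p - 1), 1 / (k : ℚ) ^ 4 *
      ((-1 : ℚ) ^ k * (p - 1).choose k - 1 + p * powSum 1 k) ∈ pMul p 2 := by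
    refine sum_mem fun k hk => pIntegral_mul_pMul (one_div_pow_mem_pIntegral hk 4) ?_
    have hk' := (Finset.mem_Icc.1 hk).2
    obtain ⟨w, hw, h'⟩ := neg_one_pow_mul_choose_expansion (p := p) (by lia) hk'
    have hh : (2 : ℚ)⁻¹ ∈ pIntegral p := by
      exact_mod_cast inv_natCast_mem_pIntegral
        (Nat.not_dvd_of_pos_of_lt (n := 2) (m := p) (by lia) (by lia))
    refine ⟨(powSum 1 k ^ 2 - powSum 2 k) * 2⁻¹ + p * w, add_mem (mul_mem (sub_mem
      (pow_mem (powSum_mem_pIntegral 1 hk') 2) (powSum_mem_pIntegral 2 hk')) hh)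
      (mul_mem (natCast_mem _ _) hw), ?_⟩
    rw [h']
    ring
  have hsplit : ∑ k ∈ Finset.Icc 1 (p - 1), 1 / (k : ℚ) ^ 4 *
      ((-1 : ℚ) ^ k * (p - 1).choose k - 1 + p * powSum 1 k) =
      p * ∑ k ∈ Finset.Icc 1 (p - 1), powSum 1 k * (1 / (k : ℚ) ^ 4)
        - powSum 4 (p - 1) - altChooseSum 4 (p - 1) := by
    rw [altChooseSum, powSum, Finset.mul_sum, sub_neg_eq_add, ← Finset.sum_sub_distrib,
      ← Finset.sum_add_distrib]
    exact Finset.sum_congr rfl fun k _ => by ring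
  rw [hsplit] at hterm
  have e := altChooseSum_four (p - 1)
  have h1 := powSum_one_mem_pMul_two hp5
  have h2 := powSum_mem_pMul_one (p := p) (r := 2) (by lia) (by lia)
  have hI : ∀ r, powSum r (p - 1) ∈ pIntegral p := fun r => powSum_mem_pIntegral r le_rfl
  have hrest := add_mem (pIntegral_mul_pMul (add_mem (add_mem (pow_mem (hI 1) 3)
    (mul_mem (natCast_mem _ 6) (mul_mem (hI 1) (hI 2)))) (mul_mem (natCast_mem _ 8) (hI 3))) h1)
    (pIntegral_mul_pMul (natCast_mem _ 3) (pMul_mul h2 h2))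
  refine pMul_of_natCast_mul (k := 6) (not_dvd_two_mul (k := 3) (by lia) (by lia) (by lia)) ?_
  convert add_mem (pIntegral_mul_pMul (natCast_mem _ 24) hterm) hrest using 1
  push_cast
  linear_combination e

theorem sum_powSum_two_mul_add_mem (hp5 : 5 < p) :
    ∑ k ∈ Finset.Icc 1 (p - 1), powSum 2 k * (1 / (k : ℚ) ^ 3)
      + 2 * ∑ k ∈ Finset.Icc 1 (p - 1), powSum 1 k * (1 / (k : ℚ) ^ 4) ∈ pMul p 1 := by
  rw [sum_powSum_mul, sum_powSum_mul]
  convert add_mem (dblSum_two_three_add_mem hp5) (pIntegral_mul_pMul (natCast_mem _ 3)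
    (powSum_mem_pMul_one (p := p) (r := 5) (by lia) (by have := seven_le_of_prime hp5; lia))) using 1
  push_cast
  ring

theorem sum_inv_sq_centralBinom_mem (hp5 : 5 < p) :
    ∑ k ∈ Finset.Icc 1 (p - 1), 1 / ((k : ℚ) ^ 2 * (2 * k).choose k)
      - 1 / 3 * (powSum 1 (p - 1) / p) ∈ pMul p 3 := by
  have hp0 : (p : ℚ) ≠ 0 := Nat.cast_ne_zero.2 hp.out.ne_zero
  have e1 := three_mul_sum_inv_centralBinom (p - 1)
  have e2 := mul_sum_inv_choose_add p (p - 1)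
  have e3 : (p : ℚ) * ∑ k ∈ Finset.Icc 1 (p - 1), 1 / ((k : ℚ) ^ 2 * (p - 1 + k).choose k) =
      p * ∑ k ∈ Finset.Icc 1 (p - 1), 1 / (k : ℚ) ^ 2 * ((p + k).choose k : ℚ)⁻¹
        + ∑ k ∈ Finset.Icc 1 (p - 1), 1 / (k : ℚ) * ((p + k).choose k : ℚ)⁻¹ := by
    rw [Finset.mul_sum, Finset.mul_sum, ← Finset.sum_add_distrib]
    refine Finset.sum_congr rfl fun k hk => ?_
    have hk0 : (k : ℚ) ≠ 0 := Nat.cast_ne_zero.2 (by have := Finset.mem_Icc.1 hk; lia)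
    have hpk : (p : ℚ) + k ≠ 0 := by positivity
    have hc : ((p + k).choose k : ℚ) ≠ 0 := Nat.cast_ne_zero.2 (Nat.choose_pos (by lia)).ne'
    rw [eq_div_of_mul_eq hpk (cast_choose_pred_add_mul (p := p) k)]
    field_simp
  have ha := sum_inv_sq_mul_inv_choose_mem hp5
  have hb := inv_choose_pred_expansion hp5
  have hc := two_mul_powSum_one_add_mem hp5
  refine pMul_of_natCast_mul (k := 6) (not_dvd_two_mul (k := 3) (by lia) (by lia) (by lia))
    (pMul_of_pow_mul 2 ?_)
  convert sub_mem (add_mem (pow_mul_pMul 2 ha) (pIntegral_mul_pMul (natCast_mem _ 2) hb))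
    (pow_mul_pMul 1 hc) using 1
  have e4 : ∀ S H : ℚ, (p : ℚ) ^ 2 * (((6 : ℕ) : ℚ) * (S - 1 / 3 * (H / p))) =
      6 * p ^ 2 * S - 2 * p * H := fun S H => by
    push_cast
    field_simp
    ring
  rw [e4]
  push_cast
  linear_combination 2 * (p : ℚ) ^ 2 * e1 + 2 * p * e3 + 2 * e2

theorem ten_mul_sum_inv_cube_centralBinom_mem (hp5 : 5 < p) :
    10 * p * ∑ k ∈ Finset.Icc 1 (p - 1), (-1 : ℚ) ^ k / ((k : ℚ) ^ 3 * (2 * k).choose k)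
      + 2 * p * powSum 3 (p - 1) - 2 * powSum 2 (p - 1)
      - 2 * p ^ 3 * ∑ k ∈ Finset.Icc 1 (p - 1), powSum 2 k * (1 / (k : ℚ) ^ 3)
      - p ^ 2 * (powSum 2 (p - 1) ^ 2 + powSum 4 (p - 1)) ∈ pMul p 4 := by
  have hp0 : (p : ℚ) ≠ 0 := Nat.cast_ne_zero.2 hp.out.ne_zero
  have e1 := five_mul_sum_inv_centralBinom (p - 1)
  have e2 := two_mul_sum_powSum_two_mul (p - 1)
  have hterm : ∑ k ∈ Finset.Icc 1 (p - 1), (p * (1 / (k : ℚ) ^ 3) + 1 / (k : ℚ) ^ 2) *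
      ((((p + k).choose k : ℚ) * ((-1 : ℚ) ^ k * (p - 1).choose k))⁻¹
        - 1 - p ^ 2 * powSum 2 k) ∈ pMul p 4 := by
    refine sum_mem fun k hk => pIntegral_mul_pMul (add_mem (mul_mem (natCast_mem _ _)
      (one_div_pow_mem_pIntegral hk 3)) (one_div_pow_mem_pIntegral hk 2)) ?_
    have hk' := (Finset.mem_Icc.1 hk).2
    obtain ⟨z, hz, h⟩ := inv_choose_mul_choose_expansion (p := p) (by lia) hk'
    have hh : (2 : ℚ)⁻¹ ∈ pIntegral p := by
      exact_mod_cast inv_natCast_mem_pIntegral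
        (Nat.not_dvd_of_pos_of_lt (n := 2) (m := p) (by lia) (by lia))
    refine ⟨(powSum 2 k ^ 2 + powSum 4 k) * 2⁻¹ + p ^ 2 * z, add_mem (mul_mem (add_mem
      (pow_mem (powSum_mem_pIntegral 2 hk') 2) (powSum_mem_pIntegral 4 hk')) hh)
      (mul_mem (pow_mem (natCast_mem _ _) 2) hz), ?_⟩
    rw [h]
    ring
  have hsplit : ∑ k ∈ Finset.Icc 1 (p - 1), (p * (1 / (k : ℚ) ^ 3) + 1 / (k : ℚ) ^ 2) *
      ((((p + k).choose k : ℚ) * ((-1 : ℚ) ^ k * (p - 1).choose k))⁻¹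
        - 1 - p ^ 2 * powSum 2 k) =
      p * ∑ k ∈ Finset.Icc 1 (p - 1),
        (-1 : ℚ) ^ k / ((k : ℚ) ^ 3 * ((p - 1).choose k * (p - 1 + k).choose k))
      - p * powSum 3 (p - 1) - powSum 2 (p - 1)
      - p ^ 3 * ∑ k ∈ Finset.Icc 1 (p - 1), powSum 2 k * (1 / (k : ℚ) ^ 3)
      - p ^ 2 * ∑ k ∈ Finset.Icc 1 (p - 1), powSum 2 k * (1 / (k : ℚ) ^ 2) := by
    have h3 : powSum 3 (p - 1) = ∑ k ∈ Finset.Icc 1 (p - 1), 1 / (k : ℚ) ^ 3 := rfl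
    have h2 : powSum 2 (p - 1) = ∑ k ∈ Finset.Icc 1 (p - 1), 1 / (k : ℚ) ^ 2 := rfl
    rw [h3, h2]
    simp only [Finset.mul_sum, ← Finset.sum_sub_distrib]
    refine Finset.sum_congr rfl fun k hk => ?_
    have hk' := Finset.mem_Icc.1 hk
    have hk0 : (k : ℚ) ≠ 0 := Nat.cast_ne_zero.2 (by lia)
    have hpk : (p : ℚ) + k ≠ 0 := by positivity
    have hc : ((p + k).choose k : ℚ) ≠ 0 := Nat.cast_ne_zero.2 (Nat.choose_pos (by lia)).ne'
    have hb : ((p - 1).choose k : ℚ) ≠ 0 := Nat.cast_ne_zero.2 (Nat.choose_pos hk'.2).ne'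
    have hs : ((-1 : ℚ) ^ k)⁻¹ = (-1) ^ k := by rw [← inv_pow, inv_neg_one]
    rw [eq_div_of_mul_eq hpk (cast_choose_pred_add_mul (p := p) k), mul_inv, mul_inv, hs]
    field_simp
    ring
  rw [hsplit] at hterm
  convert pIntegral_mul_pMul (natCast_mem _ 2) hterm using 1
  push_cast
  linear_combination 2 * (p : ℚ) * e1 + (p : ℚ) ^ 2 * e2

theorem sum_inv_cube_centralBinom_mem (hp5 : 5 < p) :
    ∑ k ∈ Finset.Icc 1 (p - 1), (-1 : ℚ) ^ k / ((k : ℚ) ^ 3 * (2 * k).choose k)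
      - -(2 / 5) * (powSum 1 (p - 1) / p ^ 2) ∈ pMul p 3 := by
  have hp0 : (p : ℚ) ≠ 0 := Nat.cast_ne_zero.2 hp.out.ne_zero
  have h2 := powSum_mem_pMul_one (p := p) (r := 2) (by lia) (by lia)
  have h5 := powSum_mem_pMul_one (p := p) (r := 5) (by lia) (by have := seven_le_of_prime hp5; lia)
  have hS := pow_mul_pMul 1 (ten_mul_sum_inv_cube_centralBinom_mem hp5)
  have hH := pIntegral_mul_pMul (natCast_mem _ 2) (two_mul_powSum_one_expansion (p := p))
  have hR := pIntegral_mul_pMul (natCast_mem _ 2)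
    (pow_mul_pMul 2 (two_mul_powSum_three_expansion (p := p)))
  have hT := pIntegral_mul_pMul (natCast_mem _ 2)
    (pow_mul_pMul 4 (sum_powSum_two_mul_add_mem hp5))
  have hA := pow_mul_pMul 3 (sum_powSum_one_mul_mem hp5)
  have hQ := pow_mul_pMul 3 (pMul_mul h2 h2)
  have hF := pIntegral_mul_pMul (natCast_mem _ 10) (pow_mul_pMul 4 h5)
  refine pMul_of_natCast_mul (k := 10) (not_dvd_two_mul (k := 5) (by lia) (by lia) (by lia))
    (pMul_of_pow_mul 2 ?_)
  -- `hH` replaces `2 H(1)` by `-p H(2) - p² H(3) - p³ H(4)`, `hR` then replaces `2 H(3)` by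
  -- `-3 p H(4)`, and `hT`, `hA` turn the double sum into `-5/2 p³ H(4)`, which cancels what is left.
  convert add_mem (sub_mem (add_mem (sub_mem (add_mem hS hH) hR) hT) hA) (add_mem hQ hF) using 1
  push_cast
  field_simp
  ring

end

theorem harmonicSum_eq_powSum (p : ℕ) : harmonicSum p = powSum 1 (p - 1) := by
  simp only [harmonicSum, powSum, pow_one]

theorem theorem4p1 (p : ℕ) (hp : p.Prime) (hp5 : 5 < p) :
    RatModEq p 3
      (∑ k ∈ Finset.Icc 1 (p - 1), 1 / ((k : ℚ) ^ 2 * ((2 * k).choose k : ℚ)))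
      ((1 / 3) * (harmonicSum p / (p : ℚ))) ∧
    RatModEq p 3
      (∑ k ∈ Finset.Icc 1 (p - 1), (-1 : ℚ) ^ k / ((k : ℚ) ^ 3 * ((2 * k).choose k : ℚ)))
      (-(2 / 5) * (harmonicSum p / (p : ℚ) ^ 2)) := by
  have : Fact p.Prime := ⟨hp⟩
  rw [harmonicSum_eq_powSum]
  exact ⟨ratModEq_of_sub_mem (sum_inv_sq_centralBinom_mem hp5),
    ratModEq_of_sub_mem (sum_inv_cube_centralBinom_mem hp5)⟩
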